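/- Theorem 1.3. Let $m\ge 1$, let $S^m\subset\mathbb{R}^{m+1}$ be the unit sphere with its geodesic distance $d(n,x)=\arccos\langle n,x\rangle$, and let $\sigma$ be the uniform Borel probability measure on $S^m$. Call $\omega\subset S^m$ convex if the cone $\{t y : t\ge 0,\ y\in\omega\}$ is a convex subset of $\mathbb{R}^{m+1}$, and put $\omega_{\pi/2}=\{x\in S^m : d(x,\omega)<\pi/2\}$. For a Borel probability measure $\mu$ on $S^m$, let $\Gamma(\sigma,\mu)$ be the set of Borel probability measures $\Pi$ on $S^m\times S^m$ such that $\Pi(A\times S^m)=\sigma(A)$ and $\Pi(S^m\times A)=\mu(A)$ for every Borel set $A\subset S^m$. Let $$c(n,x)=\begin{cases}-\log\langle n,x\rangle=-\log\cos d(n,x) & \text{if } d(n,x)<\pi/2,\\ +\infty&\text{otherwise.}\end{cases}$$ Let $\mu$ be a Borel probability measure on $S^m$. Then $\mu$ satisfies Alexandrov's condition $$\mu(\omega)<\sigma(\omega_{\pi/2})\quad\text{for every non-empty convex Borel set }\omega\subsetneq S^m$$ if and only if there exists $\Pi\in\Gamma(\sigma,\mu)$ such that $c\in L^\infty(\Pi)$.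 Moreover, for every $\Pi\in\Gamma(\sigma,\mu)$, one has $c\in L^\infty(\Pi)$ if and only if there is $\alpha>0$ such that $d(n,x)\le \pi/2-\alpha$ for $\Pi$-almost every $(n,x)$. -/

import Mathlib

open MeasureTheory Set
open scoped ENNReal

noncomputable section

namespace Alexandrov

/-- The unit sphere `S^m` of `ℝ^{m+1}`, with its Borel σ-algebra. -/
abbrev Sph (m : ℕ) : Type := Metric.sphere (0 : EuclideanSpace ℝ (Fin (m + 1))) 1

/-- The standard (geodesic) distance on `S^m`: the angle `arccos ⟪n, x⟫`, in `[0, π]`.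
(The metric that the sphere carries as a subtype is the chordal one, and is not used.) -/
def sphDist {m : ℕ} (n x : Sph m) : ℝ :=
  InnerProductGeometry.angle (n : EuclideanSpace ℝ (Fin (m + 1))) x

/-- The open `r`-neighbourhood `ω_r = {x ; d(x, ω) < r}` for the spherical distance: since
`d(x, ω)` is an infimum, `d(x, ω) < r` says that some point of `ω` is at distance less than `r`. -/
def nbhd {m : ℕ} (r : ℝ) (ω : Set (Sph m)) : Set (Sph m) :=
  {x | ∃ y ∈ ω, sphDist x y < r}

/-- The Euclidean cone `{t y ; t ≥ 0, y ∈ ω}` generated by a subset of the sphere. -/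
def cone {m : ℕ} (ω : Set (Sph m)) : Set (EuclideanSpace ℝ (Fin (m + 1))) :=
  {v | ∃ t : ℝ, 0 ≤ t ∧ ∃ y ∈ ω, v = t • (y : EuclideanSpace ℝ (Fin (m + 1)))}

/-- Spherical convexity: the Euclidean cone generated by the set is convex. -/
def SphConvex {m : ℕ} (ω : Set (Sph m)) : Prop := Convex ℝ (cone ω)

/-- The uniform Borel probability measure `σ` on `S^m`: normalized surface measure. -/
def unif (m : ℕ) : Measure (Sph m) :=
  ((volume : Measure (EuclideanSpace ℝ (Fin (m + 1)))).toSphere univ)⁻¹ •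
    (volume : Measure (EuclideanSpace ℝ (Fin (m + 1)))).toSphere

/-- Alexandrov's condition: `μ(ω) < σ(ω_{π/2})` for every non-empty (Borel) spherically convex
set `ω` other than the whole sphere. -/
def AlexandrovCondition {m : ℕ} (μ : Measure (Sph m)) : Prop :=
  ∀ ω : Set (Sph m), MeasurableSet ω → ω.Nonempty → ω ≠ univ → SphConvex ω →
    μ ω < unif m (nbhd (Real.pi / 2) ω)

/-- The set `Γ(ν, μ)` of transport plans: Borel probability measures on `S^m × S^m` with
first marginal `ν` and second marginal `μ`. -/
def transportPlans {m : ℕ} (ν μ : Measure (Sph m)) : Set (Measure (Sph m × Sph m)) :=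
  {P | IsProbabilityMeasure P ∧
    ∀ A : Set (Sph m), MeasurableSet A → ν A = P (A ×ˢ univ) ∧ μ A = P (univ ×ˢ A)}

open Classical in
/-- The cost `c(n, x) = - log ⟪n, x⟫ = - log (cos d(n, x))` if `d(n, x) < π/2`, and `+∞`
otherwise. The logarithm is nonpositive where it is used, so `ENNReal.ofReal` truncates nothing. -/
def cost {m : ℕ} (p : Sph m × Sph m) : ℝ≥0∞ :=
  if sphDist p.1 p.2 < Real.pi / 2 then
    ENNReal.ofReal (- Real.log (inner ℝ (p.1 : EuclideanSpace ℝ (Fin (m + 1))) p.2))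
  else ∞

end Alexandrov

end

/-!
Since the cost is `- log` of the inner product, it is essentially bounded under a plan exactly when
the inner product `⟪n, x⟫` is bounded below by some `ε > 0` almost everywhere, that is, when the
distance stays away from `π / 2` (`memLp_cost_iff`).

Suppose that a plan is carried by `{ε ≤ ⟪n, x⟫}`. Then `μ ω` is at most the measure of a
neighbourhood of `ω` whose radius is strictly smaller than `π / 2`. A proper convex `ω` lies in a
closed hemisphere (`exists_hemisphere`), so by connectedness of the sphere, where `1 ≤ m` is needed,
a whole open shell separates that neighbourhood from the complement of `ω_{π/2}`
(`unif_cap_lt`), and the inequality in Alexandrov's condition is strict.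

Conversely, Alexandrov's condition for convex sets controls every nonempty closed set `F`: the
bipolar of `F` is convex and has the same `π / 2`-neighbourhood as `F`
(`measure_lt_or_cap_eq_univ`). The strict inequality, and compactness of the space of closed subsets
of the sphere for the Hausdorff distance, then yield a single `ε > 0` such that
`μ F ≤ σ {n | ∃ y ∈ F, ε ≤ ⟪n, y⟫}` for all nonempty closed `F` (`exists_uniform_hall`). This is the
Hall condition for the closed relation `ε ≤ ⟪n, y⟫`, and Strassen's theorem (`exists_coupling`)
provides a plan carried by this relation. Strassen's theorem itself follows from the M. Riesz
extension theorem: by the layer cake formula the Hall condition says that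
`f ⊕ g ↦ ∫ f dν + ∫ g dμ` is positive for the order of continuous functions on the relation, and
the extension to all continuous functions is a measure by the Riesz–Markov–Kakutani theorem.
-/

namespace Alexandrov

/-! ### Strassen's theorem on compact metric spaces -/

section Coupling

variable {X Y : Type*} [MetricSpace X] [CompactSpace X] [MeasurableSpace X] [BorelSpace X]
  [MetricSpace Y] [CompactSpace Y] [MeasurableSpace Y] [BorelSpace Y]

lemma integrable_continuousMap (ν : Measure X) [IsFiniteMeasure ν] (f : C(X, ℝ)) :
    Integrable f ν :=
  (BoundedContinuousFunction.mkOfCompact f).integrable ν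

/-- The dual form of the Hall condition, obtained by the layer cake formula: on the superlevel
sets `{y | t ≤ C - g y}` and `{x | t ≤ f x + C}` it is the Hall condition itself. -/
lemma integral_add_integral_nonneg {ν : Measure X} {μ : Measure Y} [IsProbabilityMeasure ν]
    [IsProbabilityMeasure μ] {R : Set (X × Y)}
    (hall : ∀ F : Set Y, IsClosed F → F.Nonempty → μ F ≤ ν {x | ∃ y ∈ F, (x, y) ∈ R})
    (f : C(X, ℝ)) (g : C(Y, ℝ)) (hfg : ∀ p ∈ R, 0 ≤ f p.1 + g p.2) :
    0 ≤ ∫ x, f x ∂ν + ∫ y, g y ∂μ := by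
  -- Adding a constant makes both sides of `-g y ≤ f x` nonnegative.
  set C : ℝ := ‖f‖ + ‖g‖
  have hf0 : ∀ x, 0 ≤ f x + C := fun x ↦ by
    have := (abs_le.1 (f.norm_coe_le_norm x)).1
    have := norm_nonneg g
    simp only [C]; linarith
  have hg0 : ∀ y, 0 ≤ C - g y := fun y ↦ by
    have := (abs_le.1 (g.norm_coe_le_norm y)).2
    have := norm_nonneg f
    simp only [C]; linarith
  have hfi := (integrable_continuousMap ν f).add (integrable_const C)
  have hgi := (integrable_const C).sub (integrable_continuousMap μ g)
  have key : ∫⁻ y, ENNReal.ofReal (C - g y) ∂μ ≤ ∫⁻ x, ENNReal.ofReal (f x + C) ∂ν := by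
    rw [lintegral_eq_lintegral_meas_le μ (.of_forall hg0) (by fun_prop),
      lintegral_eq_lintegral_meas_le ν (.of_forall hf0) (by fun_prop)]
    refine lintegral_mono fun t ↦ ?_
    rcases {y | t ≤ C - g y}.eq_empty_or_nonempty with h | h
    · simp [h]
    · refine (hall _ (isClosed_le (by fun_prop) (by fun_prop)) h).trans (measure_mono ?_)
      rintro x ⟨y, hy, hxy⟩
      have := hfg _ hxy
      simp only [mem_ofPred_eq] at hy this ⊢
      linarith
  have key' : ∫ y, (C - g y) ∂μ ≤ ∫ x, (f x + C) ∂ν := by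
    rw [← ENNReal.ofReal_le_ofReal_iff (integral_nonneg hf0),
      ofReal_integral_eq_lintegral_ofReal (f := fun y ↦ C - g y) hgi (.of_forall hg0),
      ofReal_integral_eq_lintegral_ofReal (f := fun x ↦ f x + C) hfi (.of_forall hf0)]
    exact key
  rw [integral_sub (integrable_const C) (integrable_continuousMap μ g),
    integral_add (integrable_continuousMap ν f) (integrable_const C)] at key'
  simp only [integral_const, probReal_univ, one_smul] at key'
  linarith

/-- **Riesz–Markov–Kakutani** for linear functionals on `C(K, ℝ)` with `K` compact. -/
lemma exists_measure_of_nonneg {K : Type*} [TopologicalSpace K] [T2Space K] [CompactSpace K]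
    [MeasurableSpace K] [BorelSpace K] (φ : C(K, ℝ) →ₗ[ℝ] ℝ) (hφ : ∀ h, 0 ≤ h → 0 ≤ φ h) :
    ∃ π : Measure K, IsFiniteMeasure π ∧ ∀ h : C(K, ℝ), ∫ p, h p ∂π = φ h := by
  let Λ : CompactlySupportedContinuousMap K ℝ →ₚ[ℝ] ℝ :=
    { toFun h := φ h.toContinuousMap
      map_add' h h' := φ.map_add _ _
      map_smul' c h := φ.map_smul _ _
      monotone' h h' hh := by
        have := hφ (h'.toContinuousMap - h.toContinuousMap) (sub_nonneg.2 hh)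
        rwa [map_sub, sub_nonneg] at this }
  refine ⟨RealRMK.rieszMeasure Λ, inferInstance, fun h ↦ ?_⟩
  let h' : CompactlySupportedContinuousMap K ℝ :=
    { toContinuousMap := h
      hasCompactSupport' := .of_compactSpace _ }
  exact RealRMK.integral_rieszMeasure Λ h'

/-- **Strassen's theorem** for a closed relation `R` between compact metric spaces: under the Hall
condition for closed sets, `ν` and `μ` have a coupling carried by `R`. -/
theorem exists_coupling {ν : Measure X} {μ : Measure Y} [IsProbabilityMeasure ν]
    [IsProbabilityMeasure μ] {R : Set (X × Y)} (hR : IsClosed R)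
    (hall : ∀ F : Set Y, IsClosed F → F.Nonempty → μ F ≤ ν {x | ∃ y ∈ F, (x, y) ∈ R}) :
    ∃ P : Measure (X × Y), P.map Prod.fst = ν ∧ P.map Prod.snd = μ ∧ ∀ᵐ p ∂P, p ∈ R := by
  have : CompactSpace R := isCompact_iff_compactSpace.1 hR.isCompact
  -- Keeping `C(X) × C(Y)` as a separate factor spares the proof that the functional
  -- `f ⊕ g ↦ ∫ f dν + ∫ g dμ` on `C(R)` is well defined.
  let s : PointedCone ℝ ((C(X, ℝ) × C(Y, ℝ)) × C(R, ℝ)) :=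
    { carrier := {e | ∀ p : R, 0 ≤ e.1.1 p.1.1 + e.1.2 p.1.2 + e.2 p}
      zero_mem' := by simp
      smul_mem' := fun c e he p ↦ by
        have h1 := mul_nonneg c.2 (he p)
        have h2 : ((c • e).1.1 p.1.1 + (c • e).1.2 p.1.2 + (c • e).2 p) =
            c.1 * (e.1.1 p.1.1 + e.1.2 p.1.2 + e.2 p) := by
          rw [mul_add, mul_add]; rfl
        rw [h2]; exact h1
      add_mem' := fun {e e'} he he' p ↦ by
        have h1 := he p
        have h2 := he' p
        simp only [Prod.fst_add, Prod.snd_add, ContinuousMap.add_apply]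
        linarith }
  have hs : ∀ e, e ∈ s ↔ ∀ p : R, 0 ≤ e.1.1 p.1.1 + e.1.2 p.1.2 + e.2 p := fun e ↦ Iff.rfl
  let Λ : (C(X, ℝ) × C(Y, ℝ)) →ₗ[ℝ] ℝ :=
    { toFun e := ∫ x, e.1 x ∂ν + ∫ y, e.2 y ∂μ
      map_add' e e' := by
        have h1 : ∫ x, (e + e').1 x ∂ν = ∫ x, e.1 x ∂ν + ∫ x, e'.1 x ∂ν :=
          integral_add (integrable_continuousMap ν _) (integrable_continuousMap ν _)
        have h2 : ∫ x, (e + e').2 x ∂μ = ∫ x, e.2 x ∂μ + ∫ x, e'.2 x ∂μ :=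
          integral_add (integrable_continuousMap μ _) (integrable_continuousMap μ _)
        rw [h1, h2]; ring
      map_smul' c e := by
        have h1 : ∫ x, (c • e).1 x ∂ν = c • ∫ x, e.1 x ∂ν := integral_smul c _
        have h2 : ∫ x, (c • e).2 x ∂μ = c • ∫ x, e.2 x ∂μ := integral_smul c _
        rw [h1, h2, ← smul_add]; rfl }
  let f : ((C(X, ℝ) × C(Y, ℝ)) × C(R, ℝ)) →ₗ.[ℝ] ℝ :=
    { domain := (⊤ : Submodule ℝ (C(X, ℝ) × C(Y, ℝ))).prod ⊥
      toFun := (Λ.comp (LinearMap.fst ℝ _ _)).comp (Submodule.subtype _) }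
  obtain ⟨φ, hφf, hφs⟩ := riesz_extension s f
    (fun e he ↦ by
      refine integral_add_integral_nonneg hall _ _ fun p hp ↦ ?_
      have h0 : e.1.2 = 0 := e.2.2
      have := (hs _).1 he ⟨p, hp⟩
      rw [h0] at this
      simpa using this)
    (fun e ↦ by
      refine ⟨⟨((.const X (‖e.1.1‖ + ‖e.1.2‖ + ‖e.2‖), 0), 0), ⟨trivial, rfl⟩⟩, ?_⟩
      rw [hs]
      intro p
      have h1 := (abs_le.1 (e.1.1.norm_coe_le_norm p.1.1)).1
      have h2 := (abs_le.1 (e.1.2.norm_coe_le_norm p.1.2)).1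
      have h3 := (abs_le.1 (e.2.norm_coe_le_norm p)).1
      simp only [Prod.fst_add, Prod.snd_add, ContinuousMap.add_apply, ContinuousMap.const_apply,
        ContinuousMap.zero_apply]
      linarith)
  obtain ⟨π, hπ, hint⟩ := exists_measure_of_nonneg (φ.comp (LinearMap.inr ℝ _ _))
    (fun h hh ↦ hφs _ ((hs _).2 fun p ↦ by simpa using hh p))
  -- `φ (0, f ⊕ g) = φ ((f, g), 0)` because both `± ((f, g), - f ⊕ g)` lie in the cone.
  have hmarg : ∀ (u : C(X, ℝ)) (v : C(Y, ℝ)),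
      ∫ p : R, (u p.1.1 + v p.1.2) ∂π = ∫ x, u x ∂ν + ∫ y, v y ∂μ := by
    intro u v
    let w : C(R, ℝ) := ⟨fun p ↦ u p.1.1 + v p.1.2, by fun_prop⟩
    have h1 : φ ((u, v), 0) = ∫ x, u x ∂ν + ∫ y, v y ∂μ := hφf ⟨((u, v), 0), ⟨trivial, rfl⟩⟩
    have h2 : ∫ p : R, (u p.1.1 + v p.1.2) ∂π = φ (0, w) := hint w
    have h3 : 0 ≤ φ ((u, v), -w) := hφs _ ((hs _).2 fun p ↦ by simp [w])
    have h4 : 0 ≤ φ (-((u, v), -w)) := hφs _ ((hs _).2 fun p ↦ by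
      simp only [w, Prod.fst_neg, Prod.snd_neg, ContinuousMap.neg_apply, ContinuousMap.coe_mk]
      linarith)
    have h5 : (((u, v), -w) : (C(X, ℝ) × C(Y, ℝ)) × C(R, ℝ)) = ((u, v), 0) - (0, w) := by
      simp
    rw [map_neg, h5, map_sub] at h4
    rw [h5, map_sub] at h3
    rw [h2, ← h1]; linarith
  refine ⟨π.map Subtype.val, ?_, ?_, ?_⟩
  · rw [Measure.map_map measurable_fst measurable_subtype_coe]
    refine ext_of_forall_integral_eq_of_IsFiniteMeasure fun u ↦ ?_
    rw [integral_map (by fun_prop) (by fun_prop)]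
    simpa using hmarg u.toContinuousMap 0
  · rw [Measure.map_map measurable_snd measurable_subtype_coe]
    refine ext_of_forall_integral_eq_of_IsFiniteMeasure fun v ↦ ?_
    rw [integral_map (by fun_prop) (by fun_prop)]
    simpa using hmarg 0 v.toContinuousMap
  · exact (ae_map_iff (p := (· ∈ R)) measurable_subtype_coe.aemeasurable hR.measurableSet).2
      (.of_forall fun p ↦ p.2)

end Coupling

/-! ### The sphere and its spherical neighbourhoods -/

section Sphere

open Filter Topology

variable {m : ℕ}

instance isProbabilityMeasure_unif (m : ℕ) : IsProbabilityMeasure (unif m) := by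
  have : NeZero (volume : Measure (EuclideanSpace ℝ (Fin (m + 1)))).toSphere :=
    ⟨Measure.toSphere_ne_zero _⟩
  exact isProbabilityMeasureSMul

instance isOpenPosMeasure_unif (m : ℕ) : (unif m).IsOpenPosMeasure :=
  Measure.isOpenPosMeasure_smul _ (ENNReal.inv_ne_zero.2 (measure_ne_top _ _))

lemma cos_sphDist (n x : Sph m) : Real.cos (sphDist n x) = inner ℝ n.1 x.1 := by
  simp [sphDist, InnerProductGeometry.cos_angle]

lemma sphDist_mem_Icc (n x : Sph m) : sphDist n x ∈ Icc 0 Real.pi :=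
  ⟨InnerProductGeometry.angle_nonneg _ _, InnerProductGeometry.angle_le_pi _ _⟩

lemma sphDist_le_iff {a : ℝ} (ha : a ∈ Icc 0 Real.pi) (n x : Sph m) :
    sphDist n x ≤ a ↔ Real.cos a ≤ inner ℝ n.1 x.1 := by
  rw [← cos_sphDist, Real.strictAntiOn_cos.le_iff_ge ha (sphDist_mem_Icc n x)]

lemma sphDist_lt_pi_div_two_iff (n x : Sph m) :
    sphDist n x < Real.pi / 2 ↔ 0 < inner ℝ n.1 x.1 := by
  rw [← cos_sphDist, ← Real.cos_pi_div_two, Real.strictAntiOn_cos.lt_iff_gt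
    ⟨by positivity, by linarith [Real.pi_pos]⟩ (sphDist_mem_Icc n x)]

lemma inner_self_sph (n : Sph m) : inner ℝ n.1 n.1 = 1 := by
  simp

lemma inner_le_one (n x : Sph m) : inner ℝ n.1 x.1 ≤ 1 :=
  cos_sphDist n x ▸ Real.cos_le_one _

/-- The points whose inner product with some point of `ω` exceeds `r`: the open spherical
neighbourhood of `ω` of radius `arccos r`. -/
def cap (r : ℝ) (ω : Set (Sph m)) : Set (Sph m) :=
  {n | ∃ y ∈ ω, r < inner ℝ n.1 y.1}

lemma nbhd_pi_div_two (ω : Set (Sph m)) : nbhd (Real.pi / 2) ω = cap 0 ω := by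
  simp [nbhd, cap, sphDist_lt_pi_div_two_iff]

lemma cap_anti {r s : ℝ} (h : r ≤ s) (ω : Set (Sph m)) : cap s ω ⊆ cap r ω :=
  fun _ ⟨y, hy, hn⟩ ↦ ⟨y, hy, h.trans_lt hn⟩

lemma lt_inner_iff_dist_lt {r : ℝ} (n y : Sph m) :
    r < inner ℝ n.1 y.1 ↔ dist n y < √(2 - 2 * r) := by
  have h : dist n y ^ 2 = 2 - 2 * inner ℝ n.1 y.1 := by
    rw [Subtype.dist_eq, dist_eq_norm, @norm_sub_sq_real]
    simp; ring
  rw [Real.lt_sqrt dist_nonneg, h]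
  constructor <;> intro <;> linarith

/-- Spherical neighbourhoods are neighbourhoods for the chordal metric as well. -/
lemma mem_cap_iff {r : ℝ} {ω : Set (Sph m)} (hω : ω.Nonempty) (n : Sph m) :
    n ∈ cap r ω ↔ Metric.infDist n ω < √(2 - 2 * r) := by
  simp only [cap, mem_ofPred_eq, Metric.infDist_lt_iff hω, lt_inner_iff_dist_lt]

lemma isOpen_cap (r : ℝ) (ω : Set (Sph m)) : IsOpen (cap r ω) := by
  have : cap r ω = ⋃ y ∈ ω, {n | r < inner ℝ n.1 y.1} := by ext; simp [cap]
  rw [this]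
  exact isOpen_biUnion fun y _ ↦ isOpen_lt (by fun_prop) (by fun_prop)

/-! ### Bounded cost -/

lemma measurable_cost : Measurable (cost (m := m)) := by
  have hi : Measurable fun p : Sph m × Sph m ↦ inner ℝ p.1.1 p.2.1 := by fun_prop
  unfold cost
  refine Measurable.ite ?_ (by fun_prop) measurable_const
  simp only [sphDist_lt_pi_div_two_iff]
  exact measurableSet_lt measurable_const hi

theorem memLp_cost_iff (P : Measure (Sph m × Sph m)) :
    MemLp cost ∞ P ↔
      ∃ α : ℝ, 0 < α ∧ ∀ᵐ p ∂P, sphDist p.1 p.2 ≤ Real.pi / 2 - α := by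
  constructor
  · intro h
    have hlt : eLpNormEssSup cost P < ∞ := by simpa [eLpNorm_exponent_top] using h.2
    set C := (eLpNormEssSup cost P).toReal
    have hexp : Real.exp (-C) ≤ 1 := Real.exp_le_one_iff.2 (neg_nonpos.2 ENNReal.toReal_nonneg)
    -- A cost at most `C` means `⟪n, x⟫ ≥ exp (-C)`.
    refine ⟨Real.arcsin (Real.exp (-C)), Real.arcsin_pos.2 (Real.exp_pos _), ?_⟩
    filter_upwards [enorm_ae_le_eLpNormEssSup cost P] with p hp
    rw [← Real.arccos_eq_pi_div_two_sub_arcsin,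
      sphDist_le_iff ⟨Real.arccos_nonneg _, Real.arccos_le_pi _⟩,
      Real.cos_arccos (by linarith [Real.exp_pos (-C)]) hexp]
    rw [enorm_eq_self] at hp
    have hp' : sphDist p.1 p.2 < Real.pi / 2 := by
      by_contra hcon
      rw [cost, if_neg hcon, top_le_iff] at hp
      exact hlt.ne hp
    rw [cost, if_pos hp', ← ENNReal.ofReal_toReal hlt.ne,
      ENNReal.ofReal_le_ofReal_iff ENNReal.toReal_nonneg] at hp
    rw [sphDist_lt_pi_div_two_iff] at hp'
    rw [← Real.le_log_iff_exp_le hp']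
    linarith
  · rintro ⟨α, hα, h⟩
    refine ⟨measurable_cost.aestronglyMeasurable, ?_⟩
    rw [eLpNorm_exponent_top]
    refine eLpNormEssSup_lt_top_of_ae_enorm_bound
      (C := (-Real.log (Real.cos (Real.pi / 2 - α))).toNNReal) ?_
    filter_upwards [h] with p hp
    have h0 := (sphDist_mem_Icc p.1 p.2).1
    have hpi := Real.pi_pos
    have hlt : sphDist p.1 p.2 < Real.pi / 2 := by linarith
    have hcos : 0 < Real.cos (Real.pi / 2 - α) :=
      Real.cos_pos_of_mem_Ioo ⟨by linarith, by linarith⟩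
    rw [enorm_eq_self, cost, if_pos hlt]
    refine ENNReal.ofReal_le_ofReal (neg_le_neg (Real.log_le_log hcos ?_))
    exact (sphDist_le_iff ⟨by linarith, by linarith⟩ _ _).1 hp

/-! ### A plan of bounded cost gives Alexandrov's condition -/

/-- A convex proper subset of the sphere lies in a closed hemisphere. The set need not be closed, so
the separating hyperplane comes from the interior of its cone, or from the span of the cone when
that interior is empty. -/
lemma exists_hemisphere {ω : Set (Sph m)} (hne : ω.Nonempty) (huniv : ω ≠ univ)
    (hconv : SphConvex ω) : ∃ n : Sph m, ∀ y ∈ ω, inner ℝ n.1 y.1 ≤ 0 := by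
  suffices h : ∃ v : EuclideanSpace ℝ (Fin (m + 1)), v ≠ 0 ∧ ∀ y ∈ ω, inner ℝ v y.1 ≤ 0 by
    obtain ⟨v, hv, h⟩ := h
    refine ⟨⟨‖v‖⁻¹ • v, by simp [norm_smul, hv]⟩, fun y hy ↦ ?_⟩
    rw [real_inner_smul_left]
    exact mul_nonpos_of_nonneg_of_nonpos (by positivity) (h y hy)
  have hsub : ∀ y ∈ ω, ∀ t : ℝ, 0 ≤ t → t • y.1 ∈ cone ω := fun y hy t ht ↦ ⟨t, ht, y, hy, rfl⟩
  rcases (interior (cone ω)).eq_empty_or_nonempty with hint | hint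
  · have h0 : (0 : EuclideanSpace ℝ (Fin (m + 1))) ∈ cone ω := by
      obtain ⟨y, hy⟩ := hne
      simpa using hsub y hy 0 le_rfl
    have hspan : Submodule.span ℝ (cone ω) ≠ ⊤ := by
      intro h
      have : affineSpan ℝ (cone ω) = ⊤ := by
        rw [← AffineSubspace.coe_eq_univ_iff, ← insert_eq_of_mem h0, affineSpan_insert_zero, h]
        simp
      rw [← hconv.interior_nonempty_iff_affineSpan_eq_top, hint] at this
      exact not_nonempty_empty this
    obtain ⟨v, hv, hv0⟩ := Submodule.exists_mem_ne_zero_of_ne_bot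
      (mt (Submodule.orthogonal_eq_bot_iff).1 hspan)
    refine ⟨v, hv0, fun y hy ↦ ?_⟩
    rw [real_inner_comm]
    exact ((Submodule.mem_orthogonal _ _).1 hv _ (Submodule.subset_span
      (by simpa using hsub y hy 1 zero_le_one))).le
  · obtain ⟨p, hp⟩ := (ne_univ_iff_exists_notMem _).1 huniv
    have hpC : p.1 ∉ cone ω := by
      rintro ⟨t, ht, y, hy, hpy⟩
      have ht1 : t = 1 := by
        have := congrArg norm hpy
        simpa [norm_smul, abs_of_nonneg ht] using this.symm
      rw [ht1, one_smul] at hpy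
      exact hp (Subtype.ext hpy ▸ hy)
    obtain ⟨f, hf⟩ := geometric_hahn_banach_open_point hconv.interior isOpen_interior
      (fun h ↦ hpC (interior_subset h))
    have hle : ∀ a ∈ cone ω, f a ≤ f p.1 := by
      intro a ha
      have ha' : a ∈ closure (interior (cone ω)) := by
        rw [hconv.closure_interior_eq_closure_of_nonempty_interior hint]
        exact subset_closure ha
      exact closure_minimal (fun x hx ↦ (hf x hx).le)
        (isClosed_le f.continuous continuous_const) ha'
    refine ⟨(InnerProductSpace.toDual ℝ _).symm f, fun h0 ↦ ?_, fun y hy ↦ ?_⟩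
    · have hf0 : f = 0 := by simpa using h0
      obtain ⟨a, ha⟩ := hint
      simpa [hf0] using hf a ha
    · rw [InnerProductSpace.toDual_symm_apply]
      by_contra! hpos
      -- A positive value on `y` would make `f` unbounded on the ray through `y`.
      have h1 := hle _ (hsub y hy ((|f p.1| + 1) / f y.1) (by positivity))
      rw [map_smul, smul_eq_mul, div_mul_cancel₀ _ hpos.ne'] at h1
      linarith [le_abs_self (f p.1)]

/-- Shrinking the radius of the neighbourhood of a set contained in a hemisphere strictly decreases
the measure: by connectedness the chordal distance to the set takes the intermediate values. -/
lemma unif_cap_lt (hm : 1 ≤ m) {ω : Set (Sph m)} (hne : ω.Nonempty) {n : Sph m}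
    (hn : ∀ y ∈ ω, inner ℝ n.1 y.1 ≤ 0) {r : ℝ} (hr : 0 < r) :
    unif m (cap r ω) < unif m (cap 0 ω) := by
  have hconn : PreconnectedSpace (Sph m) := by
    refine Subtype.preconnectedSpace (isPreconnected_sphere ?_ _ _)
    rw [← Module.finrank_eq_rank, finrank_euclideanSpace_fin]
    exact_mod_cast Nat.lt_succ_of_le hm
  have hfar : √(2 - 2 * 0) ≤ Metric.infDist n ω := by
    rw [← not_lt, ← mem_cap_iff hne]
    rintro ⟨y, hy, h⟩
    exact absurd (hn y hy) (not_le.2 h)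
  have hlt : √(2 - 2 * r) < √(2 - 2 * 0) :=
    (Real.sqrt_lt_sqrt_iff_of_pos (by norm_num)).2 (by linarith)
  obtain ⟨c, hc1, hc2⟩ := exists_between hlt
  obtain ⟨y, hy⟩ := hne
  obtain ⟨z, hz⟩ : c ∈ range (fun x ↦ Metric.infDist x ω) :=
    mem_range_of_exists_le_of_exists_ge (Metric.continuous_infDist_pt ω)
      ⟨y, by
        simp only [Metric.infDist_zero_of_mem hy]
        exact (Real.sqrt_nonneg _).trans hc1.le⟩ ⟨n, hc2.le.trans hfar⟩
  set O : Set (Sph m) := {x | √(2 - 2 * r) < Metric.infDist x ω ∧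
    Metric.infDist x ω < √(2 - 2 * 0)}
  have hO : IsOpen O := (isOpen_lt continuous_const (Metric.continuous_infDist_pt ω)).inter
    (isOpen_lt (Metric.continuous_infDist_pt ω) continuous_const)
  have hdisj : Disjoint (cap r ω) O := Set.disjoint_left.2 fun x hx hxO ↦
    lt_asymm ((mem_cap_iff ⟨y, hy⟩ x).1 hx) hxO.1
  calc unif m (cap r ω) < unif m (cap r ω) + unif m O :=
        ENNReal.lt_add_right (measure_ne_top _ _)
          (hO.measure_pos _ ⟨z, by simp only [← hz] at hc1 hc2; exact ⟨hc1, hc2⟩⟩).ne'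
    _ = unif m (cap r ω ∪ O) := (measure_union hdisj hO.measurableSet).symm
    _ ≤ unif m (cap 0 ω) := measure_mono (union_subset (cap_anti hr.le ω)
        fun x hx ↦ (mem_cap_iff ⟨y, hy⟩ x).2 hx.2)

theorem alexandrovCondition_of_plan (hm : 1 ≤ m) {μ : Measure (Sph m)}
    {P : Measure (Sph m × Sph m)} (hP : P ∈ transportPlans (unif m) μ) {α : ℝ} (hα : 0 < α)
    (h : ∀ᵐ p ∂P, sphDist p.1 p.2 ≤ Real.pi / 2 - α) : AlexandrovCondition μ := by
  intro ω hω hne huniv hconv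
  obtain ⟨n, hn⟩ := exists_hemisphere hne huniv hconv
  have hpi := Real.pi_pos
  -- The angle is capped at `π / 2` so that the cosine below is monotone in the distance.
  set β := min α (Real.pi / 2)
  have hβ : 0 < β := by positivity
  have hβ' : β ≤ Real.pi / 2 := min_le_right _ _
  have hcos : 0 < Real.cos (Real.pi / 2 - β) :=
    Real.cos_pos_of_mem_Ioo ⟨by linarith, by linarith⟩
  set r := Real.cos (Real.pi / 2 - β) / 2
  rw [nbhd_pi_div_two]
  refine lt_of_le_of_lt ?_ (unif_cap_lt hm hne hn (half_pos hcos))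
  rw [(hP.2 ω hω).2, (hP.2 _ (isOpen_cap _ ω).measurableSet).1]
  refine measure_mono_ae ?_
  filter_upwards [h] with p hp hpω
  refine ⟨⟨p.2, hpω.2, ?_⟩, mem_univ _⟩
  refine (half_lt_self hcos).trans_le ((sphDist_le_iff ⟨by linarith, by linarith⟩ _ _).1 ?_)
  exact hp.trans (by linarith [min_le_left α (Real.pi / 2)])

/-! ### Alexandrov's condition gives a plan of bounded cost -/

/-- The convex hull of a set `F` is replaced by its bipolar `ω`, which is closed and has
the same open `π / 2`-neighbourhood as `F`. If `ω` is the whole sphere, so is the neighbourhood. -/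
lemma measure_lt_or_cap_eq_univ {μ : Measure (Sph m)} (hμ : AlexandrovCondition μ)
    {F : Set (Sph m)} (hF : F.Nonempty) : μ F < unif m (cap 0 F) ∨ cap 0 F = univ := by
  set ω : Set (Sph m) :=
    {x | ∀ n : Sph m, (∀ y ∈ F, inner ℝ n.1 y.1 ≤ 0) → inner ℝ n.1 x.1 ≤ 0}
  have hFω : F ⊆ ω := fun x hx n hn ↦ hn x hx
  have hcap : ∀ x y : Sph m, y ∈ ω → 0 < inner ℝ x.1 y.1 → x ∈ cap 0 F := by
    intro x y hy hxy
    by_contra hx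
    refine absurd (hy x fun z hz ↦ ?_) (not_le.2 hxy)
    by_contra! hz'
    exact hx ⟨z, hz, hz'⟩
  by_cases huniv : ω = univ
  · right
    refine eq_univ_of_forall fun x ↦ hcap x x (huniv ▸ mem_univ x) ?_
    rw [inner_self_sph]; exact one_pos
  left
  have hclosed : IsClosed ω := by
    have : ω = ⋂ n : Sph m, ⋂ _ : ∀ y ∈ F, inner ℝ n.1 y.1 ≤ 0, {x | inner ℝ n.1 x.1 ≤ 0} := by
      ext; simp [ω]
    rw [this]
    exact isClosed_iInter fun n ↦ isClosed_iInter fun _ ↦ isClosed_le (by fun_prop) (by fun_prop)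
  have hcone : cone ω = {v | ∀ n : Sph m, (∀ y ∈ F, inner ℝ n.1 y.1 ≤ 0) → inner ℝ n.1 v ≤ 0} := by
    ext v
    constructor
    · rintro ⟨t, ht, y, hy, rfl⟩ n hn
      rw [real_inner_smul_right]
      exact mul_nonpos_of_nonneg_of_nonpos ht (hy n hn)
    · intro hv
      by_cases hv0 : v = 0
      · obtain ⟨y, hy⟩ := hF
        exact ⟨0, le_rfl, y, hFω hy, by simp [hv0]⟩
      · refine ⟨‖v‖, norm_nonneg v, ⟨‖v‖⁻¹ • v, by simp [norm_smul, hv0]⟩, fun n hn ↦ ?_, ?_⟩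
        · simp only [real_inner_smul_right]
          exact mul_nonpos_of_nonneg_of_nonpos (by positivity) (hv n hn)
        · simp [smul_smul, hv0]
  have hconv : SphConvex ω := by
    rw [SphConvex, hcone]
    intro v hv w hw a b ha hb _ n hn
    rw [inner_add_right, real_inner_smul_right, real_inner_smul_right]
    have h1 := mul_nonpos_of_nonneg_of_nonpos ha (hv n hn)
    have h2 := mul_nonpos_of_nonneg_of_nonpos hb (hw n hn)
    linarith
  calc μ F ≤ μ ω := measure_mono hFω
    _ < unif m (nbhd (Real.pi / 2) ω) := hμ ω hclosed.measurableSet (hF.mono hFω) huniv hconv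
    _ ≤ unif m (cap 0 F) := by
        rw [nbhd_pi_div_two]
        exact measure_mono fun x ⟨y, hy, hxy⟩ ↦ hcap x y hy hxy

/-- Alexandrov's condition for a compact set leaves room to thicken the set and to shrink the
radius of its neighbourhood at the same time. -/
lemma exists_thickening_le {μ : Measure (Sph m)} [IsProbabilityMeasure μ]
    (hμ : AlexandrovCondition μ) {F : Set (Sph m)} (hF : IsClosed F) (hne : F.Nonempty) :
    ∃ η > 0, μ (Metric.cthickening η F) ≤ unif m (cap (2 * η) F) := by
  set u : ℕ → ℝ := fun j ↦ 1 / ((j : ℝ) + 1)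
  have hu : ∀ j, 0 < u j := fun j ↦ by positivity
  have hu0 : Tendsto u atTop (𝓝 0) := tendsto_one_div_add_atTop_nhds_zero_nat
  have hanti : Antitone u := fun i j hij ↦ by
    simp only [u]; gcongr
  have hmono : Monotone fun j ↦ cap (2 * u j) F := fun i j hij ↦
    cap_anti (by linarith [hanti hij]) F
  have hunion : ⋃ j, cap (2 * u j) F = cap 0 F := by
    refine subset_antisymm (iUnion_subset fun j ↦ cap_anti (by linarith [hu j]) F) ?_
    rintro n ⟨y, hy, hn⟩
    obtain ⟨j, hj⟩ := (hu0.eventually_lt_const (half_pos hn)).exists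
    exact mem_iUnion.2 ⟨j, y, hy, by linarith⟩
  rcases measure_lt_or_cap_eq_univ hμ hne with hlt | hcov
  · rw [← hunion] at hlt
    obtain ⟨i, hi⟩ := ((tendsto_measure_iUnion_atTop hmono).eventually_const_lt hlt).exists
    have hthick := (tendsto_measure_cthickening_of_isCompact (μ := μ) hF.isCompact).comp hu0
    obtain ⟨j, hj, hij⟩ :=
      ((hthick.eventually_lt_const hi).and (eventually_ge_atTop i)).exists
    exact ⟨u j, hu j, hj.le.trans (measure_mono (hmono hij))⟩
  · -- Here the strict inequality may fail, but finitely many of the open sets cover the sphere.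
    obtain ⟨j, hj⟩ := isCompact_univ.elim_directed_cover _ (fun j ↦ isOpen_cap (2 * u j) F)
      (hunion.trans hcov).ge hmono.directed_le
    exact ⟨u j, hu j, by rw [univ_subset_iff.1 hj, measure_univ]; exact prob_le_one⟩

/-- Compactness of the space of closed sets for the Hausdorff distance makes the Hall condition
uniform. -/
lemma exists_uniform_hall {μ : Measure (Sph m)} [IsProbabilityMeasure μ]
    (hμ : AlexandrovCondition μ) : ∃ ε > 0, ∀ F : Set (Sph m), IsClosed F → F.Nonempty →
      μ F ≤ unif m {n | ∃ y ∈ F, ε ≤ inner ℝ n.1 y.1} := by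
  have hloc : ∀ K : TopologicalSpace.NonemptyCompacts (Sph m),
      ∃ η > 0, μ (Metric.cthickening η (K : Set (Sph m))) ≤ unif m (cap (2 * η) K) :=
    fun K ↦ exists_thickening_le hμ K.isCompact.isClosed K.nonempty
  choose η hη hle using hloc
  obtain ⟨t, -, ht⟩ := isCompact_univ.elim_nhds_subcover (fun K ↦ Metric.ball K (η K))
    (fun K _ ↦ Metric.ball_mem_nhds K (hη K))
  obtain ⟨ε, hε, hεt⟩ : ∃ ε > 0, ∀ K ∈ t, ε ≤ η K := by
    have hne : t.Nonempty := by
      obtain ⟨n⟩ : Nonempty (Sph m) := nonempty_of_isProbabilityMeasure μ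
      obtain ⟨K, hK, -⟩ := mem_iUnion₂.1 (ht (mem_univ {n}))
      exact ⟨K, hK⟩
    exact ⟨t.inf' hne η, (Finset.lt_inf'_iff hne).2 fun K _ ↦ hη K,
      fun K hK ↦ Finset.inf'_le η hK⟩
  refine ⟨ε, hε, fun F hF hne ↦ ?_⟩
  obtain ⟨K, hKt, hK⟩ := mem_iUnion₂.1 (ht (mem_univ (⟨⟨F, hF.isCompact⟩, hne⟩ :
    TopologicalSpace.NonemptyCompacts (Sph m))))
  have hd : Metric.hausdorffDist F (K : Set (Sph m)) < η K := hK
  have hfin : Metric.hausdorffEDist F (K : Set (Sph m)) ≠ ∞ :=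
    Metric.hausdorffEDist_ne_top_of_nonempty_of_bounded hne K.nonempty hF.isCompact.isBounded
      K.isCompact.isBounded
  calc μ F ≤ μ (Metric.cthickening (η K) (K : Set (Sph m))) := measure_mono fun x hx ↦ by
        obtain ⟨y, hy, hxy⟩ := Metric.exists_dist_lt_of_hausdorffDist_lt hx hd hfin
        exact Metric.mem_cthickening_of_dist_le x y _ _ hy hxy.le
    _ ≤ unif m (cap (2 * η K) K) := hle K
    _ ≤ unif m {n | ∃ y ∈ F, ε ≤ inner ℝ n.1 y.1} := measure_mono fun n ⟨y, hy, hn⟩ ↦ by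
        obtain ⟨x, hx, hxy⟩ := Metric.exists_dist_lt_of_hausdorffDist_lt' hy hd hfin
        refine ⟨x, hx, ?_⟩
        have h1 : inner ℝ n.1 (y.1 - x.1) ≤ ‖n.1‖ * ‖y.1 - x.1‖ := real_inner_le_norm _ _
        rw [inner_sub_right, norm_eq_of_mem_sphere, one_mul, ← dist_eq_norm, dist_comm,
          ← Subtype.dist_eq] at h1
        linarith [hεt K hKt]

theorem exists_plan_of_alexandrovCondition {μ : Measure (Sph m)} [IsProbabilityMeasure μ]
    (hμ : AlexandrovCondition μ) : ∃ P ∈ transportPlans (unif m) μ,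
      ∃ α : ℝ, 0 < α ∧ ∀ᵐ p ∂P, sphDist p.1 p.2 ≤ Real.pi / 2 - α := by
  obtain ⟨ε, hε, hall⟩ := exists_uniform_hall hμ
  obtain ⟨P, hfst, hsnd, hP⟩ := exists_coupling (ν := unif m) (μ := μ)
    (R := {p | ε ≤ inner ℝ p.1.1 p.2.1}) (isClosed_le (by fun_prop) (by fun_prop)) hall
  refine ⟨P, ⟨⟨?_⟩, fun A hA ↦ ⟨?_, ?_⟩⟩, Real.arcsin ε, Real.arcsin_pos.2 hε, ?_⟩
  · have := Measure.map_apply (μ := P) measurable_fst MeasurableSet.univ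
    rwa [hfst, measure_univ, preimage_univ, eq_comm] at this
  · rw [← hfst, Measure.map_apply measurable_fst hA, prod_univ]
  · rw [← hsnd, Measure.map_apply measurable_snd hA, univ_prod]
  · filter_upwards [hP] with p (hp : ε ≤ _)
    rw [← Real.arccos_eq_pi_div_two_sub_arcsin,
      sphDist_le_iff ⟨Real.arccos_nonneg _, Real.arccos_le_pi _⟩,
      Real.cos_arccos (by linarith) (hp.trans (inner_le_one _ _))]
    exact hp

end Sphere

end Alexandrov

theorem theorem1p3 (m : ℕ) (hm : 1 ≤ m) (μ : MeasureTheory.Measure (Alexandrov.Sph m))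
    [MeasureTheory.IsProbabilityMeasure μ] :
    (Alexandrov.AlexandrovCondition μ ↔
      ∃ P ∈ Alexandrov.transportPlans (Alexandrov.unif m) μ,
        MeasureTheory.MemLp Alexandrov.cost ∞ P) ∧
    (∀ P ∈ Alexandrov.transportPlans (Alexandrov.unif m) μ,
      (MeasureTheory.MemLp Alexandrov.cost ∞ P ↔
        ∃ α : ℝ, 0 < α ∧ ∀ᵐ p ∂P, Alexandrov.sphDist p.1 p.2 ≤ Real.pi / 2 - α)) := by
  refine ⟨⟨fun h ↦ ?_, ?_⟩, fun P _ ↦ Alexandrov.memLp_cost_iff P⟩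
  · obtain ⟨P, hP, hα⟩ := Alexandrov.exists_plan_of_alexandrovCondition h
    exact ⟨P, hP, (Alexandrov.memLp_cost_iff P).2 hα⟩
  · rintro ⟨P, hP, hc⟩
    obtain ⟨α, hα, h⟩ := (Alexandrov.memLp_cost_iff P).1 hc
    exact Alexandrov.alexandrovCondition_of_plan hm hP hα h
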